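/- We consider online maximization problems with binary predictions. An instance is a triple $I=(x,\hat x,r)$, where $r=(r_1,\dots,r_n)$ is a sequence of requests, $x\in\{0,1\}^n$ encodes an optimal solution for $r$, and $\hat x\in\{0,1\}^n$ is arbitrary (the predictions). A deterministic online algorithm $\mathrm{ALG}$ must answer each $r_i$ irrevocably by a bit $y_i$ that depends only on $(r_1,\hat x_1),\dots,(r_i,\hat x_i)$; answering $y_i=0$ accepts $r_i$, and answering $y_i=1$ rejects it. Fix a positive integer $t$. * $\mathrm{BDIS}_t$ (Online $t$-Bounded Degree Independent Set with Predictions): $r_i$ consists of a vertex $v_i$ together with its edges to the vertices among $v_1,\dots,v_{i-1}$; every vertex of the final graph has degree at most $t$. A solution is feasible if the accepted vertices form an independent set. * $\mathrm{Sch}_t$ (Online $t$-Bounded Overlap Interval Scheduling with Predictions): $r_i$ is a nonempty interval of the real line; every requested interval overlaps (has a common point with) at most $t$ other requested intervals. A solution is feasible if no two accepted intervals overlap. In both problems the profit of a solution $y$ is $\sum_{i=1}^n(1-y_i)$ if it is feasible and $-\infty$ otherwise. Let $\mathrm{ALG}(I)$ be the profit of $\mathrm{ALG}$ on $I$ and $\mathrm{OPT}(I)$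 the largest profit of any solution. Let $$\mu_0(I)=\sum_{i=1}^n x_i(1-\hat x_i),\qquad \mu_1(I)=\sum_{i=1}^n(1-x_i)\hat x_i .$$ For constants $\alpha,\beta,\gamma\in[0,\infty)$, $\mathrm{ALG}$ is $(\alpha,\beta,\gamma)$-competitive (with respect to $(\mu_0,\mu_1)$) if there is $c\in\mathbb R$ with $$\mathrm{OPT}(I)\le\alpha\cdot\mathrm{ALG}(I)+\beta\cdot\mu_0(I)+\gamma\cdot\mu_1(I)+c\qquad\text{for all instances } I .$$ An $(\alpha,\beta,\gamma)$-competitive algorithm is Pareto-optimal if for no $\varepsilon>0$ does there exist an $(\alpha-\varepsilon,\beta,\gamma)$-, an $(\alpha,\beta-\varepsilon,\gamma)$-, or an $(\alpha,\beta,\gamma-\varepsilon)$-competitive algorithm for the same problem. A problem $Q$ is as hard as $P$ if, for all $\alpha,\beta,\gamma$, the existence of an $(\alpha,\beta,\gamma)$-competitive Pareto-optimal algorithm for $Q$ implies the existence of an $(\alpha,\beta,\gamma)$-competitive algorithm for $P$; $Q$ is exactly as hard as $P$ if each of them is as hard as the other. **Theorem.** For every positive integer $t$, $\mathrm{Sch}_t$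 is exactly as hard as $\mathrm{BDIS}_t$ with respect to $(\mu_0,\mu_1)$. -/

import Mathlib

open scoped NNReal

noncomputable section

/-- An online maximization problem with binary answers. Bits are Booleans (`false` is `0`, `true`
is `1`). `Valid r` says that `r` is a legal request sequence, and `profit r y` is the profit of
answering the sequence `r` with the bitstring `y` (`⊥ = -∞` for an infeasible solution). -/
structure OnlineMaxProblem where
  Request : Type
  Valid : {n : ℕ} → (Fin n → Request) → Prop
  profit : {n : ℕ} → (Fin n → Request) → (Fin n → Bool) → EReal

namespace OnlineMaxProblem

/-- An instance `(x, x̂, r)`: `r` is a legal request sequence, `x` encodes an optimal solution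
and `x̂` is an arbitrary bitstring of predictions. -/
structure Instance (P : OnlineMaxProblem) where
  n : ℕ
  r : Fin n → P.Request
  x : Fin n → Bool
  xhat : Fin n → Bool
  valid : P.Valid r
  optimal : ∀ y : Fin n → Bool, P.profit r y ≤ P.profit r x

/-- A deterministic online algorithm with predictions: it maps the requests and predictions
received so far (first one first, current one last) to the bit answered to the current request.
Neither the true bits nor the number of future requests are visible to it. -/
abbrev Algorithm (P : OnlineMaxProblem) : Type :=
  List (P.Request × Bool) → Bool

/-- The list of the first `i + 1` requests of `I` with their predictions. -/
def Instance.history {P : OnlineMaxProblem} (I : P.Instance) (i : Fin I.n) :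
    List (P.Request × Bool) :=
  (List.ofFn fun j : Fin I.n => (I.r j, I.xhat j)).take (i + 1)

/-- The answers `y` given by an algorithm on the instance `I`. -/
def Algorithm.output {P : OnlineMaxProblem} (A : P.Algorithm) (I : P.Instance) :
    Fin I.n → Bool :=
  fun i => A (I.history i)

/-- The profit of an algorithm on the instance `I`. -/
def algProfit {P : OnlineMaxProblem} (A : P.Algorithm) (I : P.Instance) : EReal :=
  P.profit I.r (Algorithm.output A I)

/-- The profit of an optimal solution of the instance `I`. -/
def optProfit {P : OnlineMaxProblem} (I : P.Instance) : EReal :=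
  ⨆ y : Fin I.n → Bool, P.profit I.r y

/-- `μ₀`: the number of wrong predictions where the predicted bit is `0`. -/
def mu0 {P : OnlineMaxProblem} (I : P.Instance) : ℝ≥0 :=
  ((Finset.univ.filter fun i => I.x i = true ∧ I.xhat i = false).card : ℝ≥0)

/-- `μ₁`: the number of wrong predictions where the predicted bit is `1`. -/
def mu1 {P : OnlineMaxProblem} (I : P.Instance) : ℝ≥0 :=
  ((Finset.univ.filter fun i => I.x i = false ∧ I.xhat i = true).card : ℝ≥0)

/-- `A` is `(α, β, γ)`-competitive with respect to the error measures `(η₀, η₁)`, where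
`α, β, γ ∈ [0, ∞)`. -/
def IsCompetitive {P : OnlineMaxProblem} (η₀ η₁ : P.Instance → ℝ≥0) (A : P.Algorithm)
    (α β γ : ℝ) : Prop :=
  0 ≤ α ∧ 0 ≤ β ∧ 0 ≤ γ ∧ ∃ c : ℝ, ∀ I : P.Instance,
    optProfit I ≤
      (α : EReal) * algProfit A I + ((β * (η₀ I : ℝ) + γ * (η₁ I : ℝ) + c : ℝ) : EReal)

/-- `A` is an `(α, β, γ)`-competitive Pareto-optimal algorithm: no algorithm improves one of the
three parameters while keeping the other two. -/
def IsParetoOptimal {P : OnlineMaxProblem} (η₀ η₁ : P.Instance → ℝ≥0) (A : P.Algorithm)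
    (α β γ : ℝ) : Prop :=
  IsCompetitive η₀ η₁ A α β γ ∧
    ∀ ε : ℝ, 0 < ε → ∀ B : P.Algorithm,
      ¬ IsCompetitive η₀ η₁ B (α - ε) β γ ∧
      ¬ IsCompetitive η₀ η₁ B α (β - ε) γ ∧
      ¬ IsCompetitive η₀ η₁ B α β (γ - ε)

/-- `Q` (with error measures `(φ₀, φ₁)`) is at least as hard as `P` (with error measures
`(η₀, η₁)`). -/
def AsHardAs (Q P : OnlineMaxProblem) (φ₀ φ₁ : Q.Instance → ℝ≥0)
    (η₀ η₁ : P.Instance → ℝ≥0) : Prop :=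
  ∀ α β γ : ℝ, (∃ A : Q.Algorithm, IsParetoOptimal φ₀ φ₁ A α β γ) →
    ∃ B : P.Algorithm, IsCompetitive η₀ η₁ B α β γ

/-- `Q` and `P` are at least as hard as each other. -/
def ExactlyAsHardAs (Q P : OnlineMaxProblem) (φ₀ φ₁ : Q.Instance → ℝ≥0)
    (η₀ η₁ : P.Instance → ℝ≥0) : Prop :=
  AsHardAs Q P φ₀ φ₁ η₀ η₁ ∧ AsHardAs P Q η₀ η₁ φ₀ φ₁

end OnlineMaxProblem

open Classical in
/-- The number of accepted requests (those answered by `0`) if the solution is feasible, and `-∞`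
otherwise. -/
def acceptProfit {n : ℕ} (feasible : Prop) (y : Fin n → Bool) : EReal :=
  if feasible then (((Finset.univ.filter fun i => y i = false).card : ℝ) : EReal) else ⊥

/-- The graph on `v_0, …, v_{n-1}` revealed by vertex arrivals, where `r i` is the set of indices
of the neighbours of `v_i` among the vertices that arrived earlier. -/
def arrivalGraph {n : ℕ} (r : Fin n → Finset ℕ) : SimpleGraph (Fin n) :=
  SimpleGraph.fromRel fun j i => (j : ℕ) ∈ r i

/-- Online `t`-Bounded Degree Independent Set: vertices arrive one at a time together with
their edges to previous vertices, and every vertex of the final graph has degree at most `t`. -/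
def BDIS (t : ℕ) : OnlineMaxProblem where
  Request := Finset ℕ
  Valid := fun r =>
    (∀ i, ∀ j ∈ r i, j < (i : ℕ)) ∧ ∀ v, ((arrivalGraph r).neighborSet v).ncard ≤ t
  profit := fun r y => acceptProfit ((arrivalGraph r).IsIndepSet {i | y i = false}) y

/-- Online `t`-Bounded Overlap Interval Scheduling: the requests are (nonempty) intervals of the
real line, two requests overlap if they have a common point, and every requested interval overlaps
at most `t` of the other requested intervals. -/
def Sch (t : ℕ) : OnlineMaxProblem where
  Request := {s : Set ℝ // s.Nonempty ∧ s.OrdConnected}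
  Valid := fun r => ∀ i, {j | j ≠ i ∧ ((r i : Set ℝ) ∩ (r j : Set ℝ)).Nonempty}.ncard ≤ t
  profit := fun r y => acceptProfit
    (∀ i j, i ≠ j → y i = false → y j = false → Disjoint (r i : Set ℝ) (r j : Set ℝ)) y

end

noncomputable section

/-! ### Histories, optimal values and profits -/

namespace OnlineMaxProblem

theorem optProfit_eq {P : OnlineMaxProblem} (I : P.Instance) : optProfit I = P.profit I.r I.x :=
  le_antisymm (iSup_le I.optimal) (le_iSup (fun y => P.profit I.r y) I.x)

/-- Histories are nested. -/
theorem Instance.take_history {P : OnlineMaxProblem} (I : P.Instance) {i j : Fin I.n}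
    (h : j ≤ i) : (I.history i).take (j + 1) = I.history j := by
  have : (j : ℕ) + 1 ≤ i + 1 := Nat.succ_le_succ h
  simp [Instance.history, List.take_take, this]

theorem Instance.length_history {P : OnlineMaxProblem} (I : P.Instance) (i : Fin I.n) :
    (I.history i).length = i + 1 := by
  have := i.2
  simp only [Instance.history, List.length_take, List.length_ofFn]
  omega

theorem Instance.getElem_history {P : OnlineMaxProblem} (I : P.Instance) (i : Fin I.n) (j : ℕ)
    (h : j < (I.history i).length) (hj : j < I.n) :
    (I.history i)[j] = (I.r ⟨j, hj⟩, I.xhat ⟨j, hj⟩) := by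
  simp [Instance.history]

theorem Instance.history_eq_ofFn {P : OnlineMaxProblem} (I : P.Instance) (i : Fin I.n) :
    I.history i = List.ofFn fun j : Fin (i + 1) =>
      (I.r ⟨j, j.2.trans_le i.2⟩, I.xhat ⟨j, j.2.trans_le i.2⟩) := by
  refine List.ext_getElem (by simp [I.length_history]) fun j h₁ h₂ => ?_
  rw [List.length_ofFn] at h₂
  rw [I.getElem_history i j h₁ (by omega), List.getElem_ofFn]

end OnlineMaxProblem

open OnlineMaxProblem

/-- The number of requests accepted by a solution. -/
abbrev numAccepted {n : ℕ} (y : Fin n → Bool) : ℕ :=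
  (Finset.univ.filter fun i => y i = false).card

theorem acceptProfit_of_feasible {n : ℕ} {p : Prop} (hp : p) (y : Fin n → Bool) :
    acceptProfit p y = ((numAccepted y : ℝ) : EReal) := by
  simp [acceptProfit, hp]

theorem acceptProfit_of_not_feasible {n : ℕ} {p : Prop} (hp : ¬ p) (y : Fin n → Bool) :
    acceptProfit p y = ⊥ := by
  simp [acceptProfit, hp]

/-- The solution that rejects everything shows that an optimal solution is feasible. -/
theorem feasible_of_acceptProfit_le {n : ℕ} {p q : Prop} (hp : p) {x y : Fin n → Bool}
    (h : acceptProfit p y ≤ acceptProfit q x) : q := by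
  by_contra hq
  rw [acceptProfit_of_feasible hp, acceptProfit_of_not_feasible hq, le_bot_iff] at h
  exact EReal.coe_ne_bot _ h

/-- A competitiveness bound between profits with a positive multiplier forces feasibility and is
an inequality between real numbers. -/
theorem feasible_and_le_of_acceptProfit_le {n : ℕ} {p q : Prop} (hp : p) {x y : Fin n → Bool}
    {α d : ℝ} (hα : 0 < α)
    (h : acceptProfit p x ≤ (α : EReal) * acceptProfit q y + (d : EReal)) :
    q ∧ (numAccepted x : ℝ) ≤ α * numAccepted y + d := by
  by_cases hq : q
  · refine ⟨hq, ?_⟩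
    rw [acceptProfit_of_feasible hp, acceptProfit_of_feasible hq] at h
    exact_mod_cast h
  -- In `EReal`, `0 * ⊥ = 0`, so for `α = 0` an infeasible answer would not be penalised.
  · rw [acceptProfit_of_feasible hp, acceptProfit_of_not_feasible hq,
      EReal.coe_mul_bot_of_pos hα, EReal.bot_add, le_bot_iff] at h
    exact absurd h (EReal.coe_ne_bot _)

/-! ### Reduction from intervals to their overlap graph -/

section OverlapGraph

open Classical in
/-- The request sequence of vertices that describes the overlap graph of a sequence of intervals. -/
def overlapRequest {n : ℕ} (s : ℕ → Set ℝ) (i : Fin n) : Finset ℕ :=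
  (Finset.range i).filter fun j => (s i ∩ s j).Nonempty

theorem mem_overlapRequest {n : ℕ} {s : ℕ → Set ℝ} {i : Fin n} {k : ℕ} :
    k ∈ overlapRequest s i ↔ k < i ∧ (s i ∩ s k).Nonempty := by
  simp [overlapRequest]

theorem arrivalGraph_overlapRequest_adj {n : ℕ} (s : ℕ → Set ℝ) (i j : Fin n) :
    (arrivalGraph (overlapRequest (n := n) s)).Adj i j ↔ j ≠ i ∧ (s i ∩ s j).Nonempty := by
  have key : ∀ a b : Fin n, (a : ℕ) ∈ overlapRequest s b ↔ a < b ∧ (s b ∩ s a).Nonempty := by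
    exact fun a b => mem_overlapRequest
  simp only [arrivalGraph, SimpleGraph.fromRel_adj, key, Set.inter_comm (s j) (s i)]
  constructor
  · rintro ⟨h, ⟨_, h'⟩ | ⟨_, h'⟩⟩ <;> exact ⟨h.symm, h'⟩
  · rintro ⟨h, h'⟩
    rcases lt_or_gt_of_ne h with h₁ | h₁
    · exact ⟨h.symm, .inr ⟨h₁, h'⟩⟩
    · exact ⟨h.symm, .inl ⟨h₁, h'⟩⟩

/-- A finite sequence of sets, extended by the empty set. -/
def extendSets {n : ℕ} (s : Fin n → Set ℝ) (i : ℕ) : Set ℝ :=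
  if h : i < n then s ⟨i, h⟩ else ∅

theorem extendSets_of_lt {n : ℕ} (s : Fin n → Set ℝ) {i : ℕ} (h : i < n) :
    extendSets s i = s ⟨i, h⟩ :=
  dif_pos h

variable {t : ℕ}

/-- The set of points of a requested interval. -/
def intervalSet (s : (Sch t).Request) : Set ℝ :=
  Subtype.val (p := fun s : Set ℝ => s.Nonempty ∧ s.OrdConnected) s

/-- The vertex arrivals that reveal the overlap graph of a sequence of sets. -/
def overlapArrivals {n : ℕ} (s : Fin n → Set ℝ) : Fin n → Finset ℕ :=
  overlapRequest (extendSets s)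

theorem arrivalGraph_overlapArrivals_adj {n : ℕ} (s : Fin n → Set ℝ) (i j : Fin n) :
    (arrivalGraph (overlapArrivals s)).Adj i j ↔ j ≠ i ∧ (s i ∩ s j).Nonempty := by
  refine (arrivalGraph_overlapRequest_adj _ i j).trans ?_
  rw [extendSets_of_lt s i.2, extendSets_of_lt s j.2]

theorem isIndepSet_overlapArrivals {n : ℕ} (s : Fin n → Set ℝ) (y : Fin n → Bool) :
    (arrivalGraph (overlapArrivals s)).IsIndepSet {i | y i = false} ↔
      ∀ i j, i ≠ j → y i = false → y j = false → Disjoint (s i) (s j) := by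
  refine ⟨fun h i j hij hi hj => ?_, fun h i hi j hj hij hadj => ?_⟩
  · by_contra h'
    exact h hi hj hij ((arrivalGraph_overlapArrivals_adj s i j).2
      ⟨hij.symm, Set.not_disjoint_iff_nonempty_inter.1 h'⟩)
  · exact Set.not_disjoint_iff_nonempty_inter.2
      ((arrivalGraph_overlapArrivals_adj s i j).1 hadj).2 (h i j hij hi hj)

theorem profit_overlapArrivals {n : ℕ} (r : Fin n → (Sch t).Request) (y : Fin n → Bool) :
    (BDIS t).profit (overlapArrivals fun i => intervalSet (r i)) y = (Sch t).profit r y :=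
  congrArg (fun p => acceptProfit p y)
    (propext (isIndepSet_overlapArrivals (fun i => intervalSet (r i)) y))

/-- The instance of the independent set problem given by the overlap graph. -/
def overlapInstance (I : (Sch t).Instance) : (BDIS t).Instance where
  n := I.n
  r := overlapArrivals fun i => intervalSet (I.r i)
  x := I.x
  xhat := I.xhat
  valid := by
    refine ⟨fun i j hj => ?_, fun v => ?_⟩
    · exact (mem_overlapRequest.1 hj).1
    · have : (arrivalGraph (overlapArrivals fun i => intervalSet (I.r i))).neighborSet v =
          {j | j ≠ v ∧ (intervalSet (I.r v) ∩ intervalSet (I.r j)).Nonempty} :=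
        Set.ext fun j => arrivalGraph_overlapArrivals_adj _ v j
      rw [this]
      exact I.valid v
  optimal := fun y => by
    rw [profit_overlapArrivals, profit_overlapArrivals]
    exact I.optimal y

/-- An algorithm for independent sets, run on the overlap graph of the intervals. -/
def overlapAlgorithm (A : (BDIS t).Algorithm) : (Sch t).Algorithm := fun L =>
  A (List.ofFn fun i : Fin L.length =>
    (overlapArrivals (fun k : Fin L.length => intervalSet (L.get k).1) i, (L.get i).2))

/-- Each vertex request depends only on the current and earlier intervals, so translating a prefix
of the intervals gives a prefix of the translated instance. -/
theorem output_overlapAlgorithm (A : (BDIS t).Algorithm) (I : (Sch t).Instance) :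
    Algorithm.output (overlapAlgorithm A) I = Algorithm.output A (overlapInstance I) := by
  funext i
  change A (List.ofFn _) = A ((overlapInstance I).history i)
  congr 1
  have hn : (i : ℕ) < I.n := i.2
  have hlen : ((overlapInstance I).history i).length = i + 1 := Instance.length_history _ _
  refine List.ext_getElem ?_ fun j h₁ h₂ => ?_
  · exact (List.length_ofFn).trans ((I.length_history i).trans hlen.symm)
  have hj : j < (i : ℕ) + 1 := by rwa [hlen] at h₂
  have hjn : j < I.n := by omega
  rw [Instance.getElem_history (overlapInstance I) i j h₂ hjn, List.getElem_ofFn]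
  refine Prod.ext ?_ ?_
  · have ext_eq : ∀ k : ℕ, k < (i : ℕ) + 1 →
        extendSets (fun k => intervalSet ((I.history i).get k).1) k =
          extendSets (fun k => intervalSet (I.r k)) k := by
      intro k hk
      have hkn : k < I.n := by omega
      have hk' : k < (I.history i).length := by rwa [Instance.length_history]
      rw [extendSets_of_lt _ hk', extendSets_of_lt _ hkn, List.get_eq_getElem,
        Instance.getElem_history I i k hk' hkn]
    refine Finset.ext fun k => mem_overlapRequest.trans (Iff.trans ?_ mem_overlapRequest.symm)
    refine and_congr_right fun hk : k < j => ?_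
    exact iff_of_eq (congrArg Set.Nonempty
      (congrArg₂ (· ∩ ·) (ext_eq j hj) (ext_eq k (by omega))))
  · change ((I.history i).get _).2 = I.xhat ⟨j, hjn⟩
    rw [List.get_eq_getElem, Instance.getElem_history I i j _ hjn]

/-- The translation keeps `x`, `xhat` and all profits, hence also both error measures. -/
theorem isCompetitive_overlapAlgorithm {A : (BDIS t).Algorithm} {α β γ : ℝ}
    (h : IsCompetitive mu0 mu1 A α β γ) : IsCompetitive mu0 mu1 (overlapAlgorithm A) α β γ := by
  obtain ⟨hα, hβ, hγ, c, hc⟩ := h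
  refine ⟨hα, hβ, hγ, c, fun I => ?_⟩
  have h := hc (overlapInstance I)
  have hopt : optProfit (overlapInstance I) = optProfit I := by
    rw [optProfit_eq, optProfit_eq]
    exact profit_overlapArrivals I.r I.x
  have halg : algProfit A (overlapInstance I) = algProfit (overlapAlgorithm A) I := by
    rw [algProfit, algProfit, output_overlapAlgorithm]
    exact profit_overlapArrivals I.r _
  rw [hopt, halg] at h
  exact h

end OverlapGraph

/-! ### Greedy algorithms for independent sets -/

section Greedy

/-- The vertex set that is the `i`-th request. -/
def OnlineMaxProblem.Instance.earlierNeighbors {t : ℕ} (I : (BDIS t).Instance) :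
    Fin I.n → Finset ℕ := I.r

theorem List.length_take_succ_lt {α : Type*} (L : List α) (j : Fin (L.length - 1)) :
    (L.take (j + 1)).length < L.length := by
  have := j.2
  rw [List.length_take]
  omega

open Classical in
/-- The greedy algorithm that considers only the vertices whose prediction passes the test `p`. -/
def greedyIndepSet (p : Bool → Prop) (L : List (Finset ℕ × Bool)) : Bool :=
  -- The last entry has index `L.length - 1`, so `j` runs over strictly earlier vertices, and
  -- `L.take (j + 1)` is the history on which `j` was answered.
  !decide (∃ v, L.getLast? = some v ∧ p v.2 ∧
    ∀ j : Fin (L.length - 1), (j : ℕ) ∈ v.1 → greedyIndepSet p (L.take (j + 1)) = true)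
termination_by L.length
decreasing_by
  all_goals exact List.length_take_succ_lt L _

theorem greedyIndepSet_eq_false (p : Bool → Prop) (L : List (Finset ℕ × Bool)) :
    greedyIndepSet p L = false ↔ ∃ v, L.getLast? = some v ∧ p v.2 ∧
      ∀ j : Fin (L.length - 1), (j : ℕ) ∈ v.1 → greedyIndepSet p (L.take (j + 1)) = true := by
  classical
  rw [greedyIndepSet, Bool.not_eq_false', decide_eq_true_iff]

variable {t : ℕ}

theorem output_greedyIndepSet (p : Bool → Prop) (I : (BDIS t).Instance) (i : Fin I.n) :
    Algorithm.output (P := BDIS t) (greedyIndepSet p) I i = false ↔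
      p (I.xhat i) ∧ ∀ j < i, (j : ℕ) ∈ I.earlierNeighbors i →
        Algorithm.output (P := BDIS t) (greedyIndepSet p) I j = true := by
  have hlen := I.length_history i
  have hlast : (I.history i).getLast? = some (I.r i, I.xhat i) := by
    rw [List.getLast?_eq_getElem?, List.getElem?_eq_some_iff]
    refine ⟨by omega, ?_⟩
    rw [Instance.getElem_history I i _ _ (by have := i.2; omega)]
    simp [hlen]
  unfold Algorithm.output
  refine (greedyIndepSet_eq_false p _).trans ?_
  constructor
  · rintro ⟨v, hv, hp, h⟩
    obtain rfl : (I.r i, I.xhat i) = v := Option.some.inj (hlast.symm.trans hv)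
    refine ⟨hp, fun j hj hjr => ?_⟩
    have := h ⟨j, show (j : ℕ) < (I.history i).length - 1 by rw [Fin.lt_def] at hj; omega⟩ hjr
    exact (congrArg (greedyIndepSet p) (Instance.take_history I hj.le)).symm.trans this
  · rintro ⟨hp, h⟩
    refine ⟨_, hlast, hp, fun j hjr => ?_⟩
    have hji : (j : ℕ) < i := by
      have : (j : ℕ) < (I.history i).length - 1 := j.2
      omega
    have hjn : (j : ℕ) < I.n := hji.trans i.2
    have := h ⟨j, hjn⟩ hji hjr
    exact (congrArg (greedyIndepSet p)
      (Instance.take_history I (i := i) (j := ⟨j, hjn⟩) hji.le)).trans this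

theorem arrivalGraph_adj_of_mem {n : ℕ} {r : Fin n → Finset ℕ} {i j : Fin n} (hij : j < i)
    (h : (j : ℕ) ∈ r i) : (arrivalGraph r).Adj j i :=
  (SimpleGraph.fromRel_adj _ _ _).2 ⟨hij.ne, .inl h⟩

/-- Every edge is listed by its later endpoint, which greedy rejects once the earlier one is
accepted. -/
theorem isIndepSet_greedyIndepSet (p : Bool → Prop) (I : (BDIS t).Instance) :
    (arrivalGraph I.r).IsIndepSet
      {i | Algorithm.output (P := BDIS t) (greedyIndepSet p) I i = false} := by
  have key : ∀ a b : Fin I.n,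
      Algorithm.output (P := BDIS t) (greedyIndepSet p) I a = false →
      Algorithm.output (P := BDIS t) (greedyIndepSet p) I b = false → (a : ℕ) ∉ I.earlierNeighbors b := by
    intro a b ha hb hab
    have := ((output_greedyIndepSet p I b).1 hb).2 a (I.valid.1 b a hab) hab
    rw [ha] at this
    exact Bool.false_ne_true this
  intro i hi j hj _ hij
  rcases ((SimpleGraph.fromRel_adj _ _ _).1 hij).2 with h | h
  · exact key i j hi hj h
  · exact key j i hj hi h

theorem isIndepSet_optimal (I : (BDIS t).Instance) :
    (arrivalGraph I.r).IsIndepSet {i | I.x i = false} :=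
  feasible_of_acceptProfit_le (p := (arrivalGraph I.r).IsIndepSet {i | true = false})
    (by simp [SimpleGraph.IsIndepSet]) (I.optimal fun _ => true)

open Classical in
/-- Every vertex of the optimal solution that is missed by the greedy algorithm failed the test or
is blocked by an accepted vertex outside the optimal solution. -/
theorem card_missed_le (p : Bool → Prop) (I : (BDIS t).Instance) :
    let y := Algorithm.output (P := BDIS t) (greedyIndepSet p) I
    (Finset.univ.filter fun i => I.x i = false ∧ y i = true).card ≤
      (Finset.univ.filter fun i => I.x i = false ∧ ¬ p (I.xhat i)).card +
        (Finset.univ.filter fun i => I.x i = true ∧ y i = false).card * t := by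
  intro y
  have hsub : (Finset.univ.filter fun i => I.x i = false ∧ y i = true) ⊆
      (Finset.univ.filter fun i => I.x i = false ∧ ¬ p (I.xhat i)) ∪
        (Finset.univ.filter fun i => I.x i = true ∧ y i = false).biUnion
          fun v => Finset.univ.filter fun w => (arrivalGraph I.r).Adj v w := by
    intro i hi
    simp only [Finset.mem_filter, Finset.mem_univ, true_and] at hi
    simp only [Finset.mem_union, Finset.mem_biUnion, Finset.mem_filter, Finset.mem_univ, true_and]
    by_cases hp : p (I.xhat i)
    · right
      have hn : ¬ (y i = false) := by simp [hi.2]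
      have h' := mt (output_greedyIndepSet p I i).2 hn
      push Not at h'
      obtain ⟨j, hj, hjr, hjy⟩ := h' hp
      have hadj := arrivalGraph_adj_of_mem hj hjr
      refine ⟨j, ⟨?_, by simpa using hjy⟩, hadj⟩
      -- The blocker `j` is adjacent to `i`, which the optimal solution accepts, so that solution
      -- rejects `j`.
      by_contra hx
      exact isIndepSet_optimal I (by simpa using hx) hi.1 hj.ne hadj
    · exact .inl ⟨hi.1, hp⟩
  refine (Finset.card_le_card hsub).trans ((Finset.card_union_le _ _).trans ?_)
  gcongr
  refine Finset.card_biUnion_le_card_mul _ _ _ fun v _ => ?_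
  have := I.valid.2 v
  rwa [Set.ncard_eq_toFinset_card', ← SimpleGraph.neighborFinset_def,
    SimpleGraph.neighborFinset_eq_filter] at this

theorem numAccepted_eq_add {n : ℕ} (x y : Fin n → Bool) :
    numAccepted x = (Finset.univ.filter fun i => x i = false ∧ y i = false).card +
      (Finset.univ.filter fun i => x i = false ∧ y i = true).card := by
  rw [numAccepted, ← Finset.card_filter_add_card_filter_not (fun i => y i = false),
    Finset.filter_filter, Finset.filter_filter]
  simp

open Classical in
/-- The performance of the greedy algorithm in terms of the number of accepted vertices that
are rejected by the optimal solution. -/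
theorem exists_greedyIndepSet_bound (p : Bool → Prop) (I : (BDIS t).Instance) :
    ∃ a w m : ℕ, optProfit I = ((m : ℝ) : EReal) ∧
      algProfit (P := BDIS t) (greedyIndepSet p) I = ((a : ℝ) : EReal) ∧ w ≤ a ∧
      w ≤ (Finset.univ.filter fun i => I.x i = true ∧ p (I.xhat i)).card ∧
      m + w ≤ a + w * t + (Finset.univ.filter fun i => I.x i = false ∧ ¬ p (I.xhat i)).card := by
  set y := Algorithm.output (P := BDIS t) (greedyIndepSet p) I with hy
  have h₁ := card_missed_le p I
  have h₂ := numAccepted_eq_add I.x y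
  have h₃ := numAccepted_eq_add y I.x
  simp only [and_comm (a := y _ = false)] at h₃
  -- If `k` vertices are accepted by both solutions, then `a = k + w` and `m = k + missed`, so `m +
  -- w = a + missed`; `card_missed_le` bounds the missed ones.
  refine ⟨numAccepted y, (Finset.univ.filter fun i => I.x i = true ∧ y i = false).card,
    numAccepted I.x, ?_, acceptProfit_of_feasible (isIndepSet_greedyIndepSet p I) y,
    by omega, ?_, ?_⟩
  · rw [optProfit_eq]
    exact acceptProfit_of_feasible (isIndepSet_optimal I) I.x
  · refine Finset.card_le_card fun i hi => ?_
    simp only [Finset.mem_filter, Finset.mem_univ, true_and] at hi ⊢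
    exact ⟨hi.1, ((output_greedyIndepSet p I i).1 hi.2).1⟩
  · simp only [← hy] at h₁
    convert (show _ + _ ≤ _ + _ + _ from ?_) using 2
    omega

/-- No vertex fails the test, so `m ≤ a + w * (t - 1) ≤ t * a`, using `w ≤ a`. -/
theorem isCompetitive_greedy {α β γ : ℝ} (hα : (t : ℝ) ≤ α) (ht : 0 < t) (hβ : 0 ≤ β)
    (hγ : 0 ≤ γ) :
    IsCompetitive (P := BDIS t) mu0 mu1 (greedyIndepSet fun _ => True) α β γ := by
  refine ⟨le_trans (by positivity) hα, hβ, hγ, 0, fun I => ?_⟩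
  obtain ⟨a, w, m, hm, ha, hwa, -, h⟩ := exists_greedyIndepSet_bound (fun _ => True) I
  rw [hm, ha]
  simp only [not_true_eq_false, and_false, Finset.filter_false, Finset.card_empty] at h
  have h' : (m : ℝ) + w ≤ a + w * t := by exact_mod_cast h
  have hwa' : (w : ℝ) ≤ a := by exact_mod_cast hwa
  have ht' : (1 : ℝ) ≤ t := by exact_mod_cast ht
  have h0 : 0 ≤ β * (mu0 I : ℝ) + γ * (mu1 I : ℝ) := by positivity
  have : (m : ℝ) ≤ α * a + (β * (mu0 I : ℝ) + γ * (mu1 I : ℝ) + 0) := by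
    nlinarith [mul_nonneg (sub_nonneg.2 hwa') (sub_nonneg.2 ht'),
      mul_nonneg (sub_nonneg.2 hα) (Nat.cast_nonneg (α := ℝ) a)]
  exact_mod_cast this

/-- Here `m ≤ a + w * (t - 1) + μ₁`, where `w` is at most both `a` and `μ₀`. Splitting `t - 1 ≤ (α -
1) + β`, the first share of `w` is paid by `a` and the second by `μ₀`. -/
theorem isCompetitive_trusting {α β γ : ℝ} (hα : 1 ≤ α) (hβ : 0 ≤ β) (hαβ : (t : ℝ) ≤ α + β)
    (hγ : 1 ≤ γ) :
    IsCompetitive (P := BDIS t) mu0 mu1 (greedyIndepSet fun b => b = false) α β γ := by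
  refine ⟨by linarith, hβ, by linarith, 0, fun I => ?_⟩
  obtain ⟨a, w, m, hm, ha, hwa, hw, h⟩ := exists_greedyIndepSet_bound (fun b => b = false) I
  rw [hm, ha]
  have hw' : (w : ℝ) ≤ (mu0 I : ℝ) := by
    rw [mu0, NNReal.coe_natCast]
    exact Nat.cast_le.2 (by convert hw)
  have h' : (m : ℝ) + w ≤ a + w * t + (mu1 I : ℝ) := by
    rw [mu1, NNReal.coe_natCast]
    simp only [Bool.not_eq_false] at h
    exact_mod_cast h
  have hwa' : (w : ℝ) ≤ a := by exact_mod_cast hwa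
  have : (m : ℝ) ≤ α * a + (β * (mu0 I : ℝ) + γ * (mu1 I : ℝ) + 0) := by
    nlinarith [mul_nonneg (sub_nonneg.2 hα) (sub_nonneg.2 hwa'),
      mul_nonneg hβ (sub_nonneg.2 hw'), mul_nonneg (sub_nonneg.2 hγ) (mu1 I).2,
      mul_nonneg (sub_nonneg.2 hαβ) (Nat.cast_nonneg (α := ℝ) w)]
  exact_mod_cast this

end Greedy

/-! ### Adversarial interval instances and lower bounds -/

section Adversary

/-- The interval `[k, k + 1)`. -/
def cell (k : ℕ) : {s : Set ℝ // s.Nonempty ∧ s.OrdConnected} :=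
  ⟨Set.Ico (k : ℝ) (k + 1), ⟨k, by simp⟩, Set.ordConnected_Ico⟩

/-- A one-point interval contained in `[k, k + 1)`. -/
def pointInCell (k j : ℕ) : {s : Set ℝ // s.Nonempty ∧ s.OrdConnected} :=
  ⟨{(k : ℝ) + 1 / (j + 2)}, Set.singleton_nonempty _, Set.ordConnected_singleton⟩

theorem eq_of_mem_cell {k l : ℕ} {x : ℝ} (hk : x ∈ (cell k : Set ℝ)) (hl : x ∈ (cell l : Set ℝ)) :
    k = l := by
  have h₁ : (k : ℝ) < l + 1 := hk.1.trans_lt hl.2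
  have h₂ : (l : ℝ) < k + 1 := hl.1.trans_lt hk.2
  norm_cast at h₁ h₂
  omega

/-- The shift by `2` keeps the offset below `1`; `1 / (j + 1)` would reach the excluded endpoint at
`j = 0`. -/
theorem mem_cell (k j : ℕ) : (k : ℝ) + 1 / (j + 2) ∈ (cell k : Set ℝ) := by
  have h : (1 : ℝ) / (j + 2) < 1 := by
    rw [div_lt_one (by positivity)]
    linarith [Nat.cast_nonneg (α := ℝ) j]
  exact ⟨le_add_of_nonneg_right (by positivity), by linarith⟩

theorem pointInCell_injective {k l i j : ℕ}
    (h : (k : ℝ) + 1 / (i + 2) = (l : ℝ) + 1 / (j + 2)) : k = l ∧ i = j := by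
  obtain rfl : k = l := eq_of_mem_cell (mem_cell k i) (h ▸ mem_cell l j)
  refine ⟨rfl, ?_⟩
  have h' := add_left_cancel h
  rw [one_div, one_div, inv_inj] at h'
  exact_mod_cast add_right_cancel h'

variable {t N : ℕ}

/-- Indices of the adversary's intervals: `N` cells, and `t` points in each of the cells
of `S`. -/
abbrev StarIndex (t : ℕ) {N : ℕ} (S : Finset (Fin N)) : Type := Fin N ⊕ (S × Fin t)

/-- The cells are requested first. -/
def starOrder (t : ℕ) (S : Finset (Fin N)) : Fin (N + S.card * t) ≃ StarIndex t S :=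
  finSumFinEquiv.symm.trans (Equiv.sumCongr (Equiv.refl _)
    (finProdFinEquiv.symm.trans (Equiv.prodCongr S.equivFin.symm (Equiv.refl _))))

theorem starOrder_castAdd (S : Finset (Fin N)) (i : Fin N) :
    starOrder t S (Fin.castAdd _ i) = .inl i := by
  simp [starOrder]

/-- The cells `[0, 1), …, [N - 1, N)`, and `t` points in each of the cells of `S`. -/
def starInterval (S : Finset (Fin N)) :
    StarIndex t S → {s : Set ℝ // s.Nonempty ∧ s.OrdConnected} :=
  Sum.elim (fun i => cell i) fun p => pointInCell p.1.1 p.2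

/-- The optimal solution rejects exactly the cells of `S`. -/
def starSolution (S : Finset (Fin N)) : StarIndex t S → Bool :=
  Sum.elim (fun i => decide (i ∈ S)) fun _ => false

/-- Every cell has the prediction `b`, and every point is predicted to be accepted. -/
def starPrediction (b : Bool) (S : Finset (Fin N)) : StarIndex t S → Bool :=
  Sum.elim (fun _ => b) fun _ => false

/-- The overlap graph is a disjoint union of stars with `t` leaves, centred at the cells of `S`, and
isolated cells. -/
theorem starInterval_overlap {S : Finset (Fin N)} {u v : StarIndex t S} (huv : u ≠ v) :
    ((starInterval S u : Set ℝ) ∩ (starInterval S v : Set ℝ)).Nonempty ↔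
      (∃ p, u = .inl p.1.1 ∧ v = .inr p) ∨ ∃ p, u = .inr p ∧ v = .inl p.1.1 := by
  rcases u with i | p <;> rcases v with j | q
  · refine iff_of_false ?_ (by simp)
    rintro ⟨x, hi, hj⟩
    exact huv (congrArg _ (Fin.ext (eq_of_mem_cell hi hj)))
  · constructor
    · rintro ⟨x, hi, rfl⟩
      exact .inl ⟨q, congrArg _ (Fin.ext (eq_of_mem_cell hi (mem_cell _ _))), rfl⟩
    · rintro (⟨p, h₁, h₂⟩ | ⟨p, h₁, -⟩)
      · cases h₁
        cases h₂
        exact ⟨_, mem_cell _ _, rfl⟩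
      · cases h₁
  · constructor
    · rintro ⟨x, rfl, hj⟩
      exact .inr ⟨p, rfl, congrArg _ (Fin.ext (eq_of_mem_cell hj (mem_cell _ _)))⟩
    · rintro (⟨p, h₁, -⟩ | ⟨p, h₁, h₂⟩)
      · cases h₁
      · cases h₁
        cases h₂
        exact ⟨_, rfl, mem_cell _ _⟩
  · refine iff_of_false ?_ (by simp)
    rintro ⟨x, hp, hq⟩
    obtain ⟨h₁, h₂⟩ := pointInCell_injective (Eq.trans (Eq.symm hp) hq)
    exact huv (congrArg _ (Prod.ext (Subtype.ext (Fin.ext h₁)) (Fin.ext h₂)))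

theorem starInterval_valid (ht : 0 < t) (S : Finset (Fin N)) :
    (Sch t).Valid fun i => starInterval S (starOrder t S i) := by
  intro i
  set e := starOrder t S with he
  -- Covering the neighbours by the image of `Fin t` bounds their number by `t`. A centre uses its
  -- leaves, a leaf the constant map to its centre, and an isolated cell an arbitrary map.
  obtain ⟨f, hf⟩ : ∃ f : Fin t → StarIndex t S, ∀ v, v ≠ e i →
      ((starInterval S (e i) : Set ℝ) ∩ (starInterval S v : Set ℝ)).Nonempty →
        v ∈ Set.range f := by
    rcases hu : e i with k | p
    · by_cases hk : k ∈ S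
      · refine ⟨fun j => .inr (⟨k, hk⟩, j), fun v hv h => ?_⟩
        rcases (starInterval_overlap hv.symm).1 h with ⟨q, h₁, rfl⟩ | ⟨q, h₁, -⟩
        · cases h₁
          exact ⟨q.2, rfl⟩
        · cases h₁
      · refine ⟨fun _ => .inl k, fun v hv h => ?_⟩
        rcases (starInterval_overlap hv.symm).1 h with ⟨q, h₁, -⟩ | ⟨q, h₁, -⟩
        · cases h₁
          exact absurd q.1.2 hk
        · cases h₁
    · refine ⟨fun _ => .inl p.1.1, fun v hv h => ?_⟩
      rcases (starInterval_overlap hv.symm).1 h with ⟨q, h₁, -⟩ | ⟨q, h₁, rfl⟩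
      · cases h₁
      · cases h₁
        exact ⟨⟨0, ht⟩, rfl⟩
  have hsub : {j | j ≠ i ∧ ((starInterval S (e i) : Set ℝ) ∩
      (starInterval S (e j) : Set ℝ)).Nonempty} ⊆ (fun j => e.symm (f j)) '' Set.univ := by
    rintro j ⟨hj, h⟩
    obtain ⟨l, hl⟩ := hf (e j) (e.injective.ne hj) h
    exact ⟨l, trivial, by simp [hl]⟩
  refine (Set.ncard_le_ncard hsub (Set.toFinite _)).trans ((Set.ncard_image_le).trans ?_)
  simp [Set.ncard_univ]

theorem card_filter_starOrder (S : Finset (Fin N)) (p : StarIndex t S → Prop) [DecidablePred p] :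
    (Finset.univ.filter fun i => p (starOrder t S i)).card = (Finset.univ.filter p).card :=
  Finset.card_equiv (starOrder t S) (by simp)

theorem card_filter_starIndex (S : Finset (Fin N)) (p : StarIndex t S → Prop) [DecidablePred p] :
    (Finset.univ.filter p).card = (Finset.univ.filter fun i => p (.inl i)).card +
      (Finset.univ.filter fun q => p (.inr q)).card := by
  simp only [Finset.card_filter, Fintype.sum_sum_type]

theorem card_filter_not_mem_add (S : Finset (Fin N)) :
    (Finset.univ.filter fun i => i ∉ S).card + S.card = N := by
  have := Finset.card_filter_add_card_filter_not (s := (Finset.univ : Finset (Fin N))) (· ∈ S)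
  simp at this ⊢
  omega

theorem numAccepted_starSolution (S : Finset (Fin N)) :
    numAccepted (fun i => starSolution S (starOrder t S i)) + S.card = N + S.card * t := by
  rw [numAccepted, card_filter_starOrder S (fun u => starSolution S u = false),
    card_filter_starIndex, add_right_comm]
  congr 1
  · simpa [starSolution] using card_filter_not_mem_add S
  · simp [starSolution]

/-- Feasibility of a solution for the adversary's intervals. -/
theorem starSolution_feasible (S : Finset (Fin N)) (i j : Fin (N + S.card * t)) (hij : i ≠ j)
    (hi : starSolution S (starOrder t S i) = false)
    (hj : starSolution S (starOrder t S j) = false) :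
    Disjoint (starInterval S (starOrder t S i) : Set ℝ) (starInterval S (starOrder t S j)) := by
  by_contra h
  rcases (starInterval_overlap ((starOrder t S).injective.ne hij)).1
    (Set.not_disjoint_iff_nonempty_inter.1 h) with ⟨p, h₁, -⟩ | ⟨p, -, h₁⟩
  · rw [h₁] at hi
    simp [starSolution] at hi
  · rw [h₁] at hj
    simp [starSolution] at hj

theorem eq_true_of_feasible {S : Finset (Fin N)} {y : Fin (N + S.card * t) → Bool}
    (hy : ∀ i j, i ≠ j → y i = false → y j = false →
      Disjoint (starInterval S (starOrder t S i) : Set ℝ) (starInterval S (starOrder t S j)))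
    (p : S × Fin t) (h : y ((starOrder t S).symm (.inl p.1.1)) = false) :
    y ((starOrder t S).symm (.inr p)) = true := by
  by_contra h'
  have := hy _ _ ((starOrder t S).symm.injective.ne Sum.inl_ne_inr) h (by simpa using h')
  rw [Equiv.apply_symm_apply, Equiv.apply_symm_apply] at this
  exact Set.not_disjoint_iff_nonempty_inter.2
    ((starInterval_overlap Sum.inl_ne_inr).2 (.inl ⟨p, rfl, rfl⟩)) this

/-- Exchange argument: replace each accepted cell of `S` by its first point. Feasibility forces that
point to be rejected by `y`, so the replacement is injective. -/
theorem numAccepted_le_starSolution (ht : 0 < t) {S : Finset (Fin N)}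
    {y : Fin (N + S.card * t) → Bool}
    (hy : ∀ i j, i ≠ j → y i = false → y j = false →
      Disjoint (starInterval S (starOrder t S i) : Set ℝ) (starInterval S (starOrder t S j))) :
    numAccepted y ≤ numAccepted fun i => starSolution S (starOrder t S i) := by
  have hy' := card_filter_starOrder S fun u => y ((starOrder t S).symm u) = false
  simp only [Equiv.symm_apply_apply] at hy'
  rw [numAccepted, numAccepted, hy', card_filter_starOrder S fun u => starSolution S u = false]
  let φ : StarIndex t S → StarIndex t S := Sum.elim
    (fun i => if h : i ∈ S then .inr (⟨i, h⟩, ⟨0, ht⟩) else .inl i) .inr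
  refine Finset.card_le_card_of_injOn φ (fun u _ => Finset.mem_coe.2 (Finset.mem_filter.2 ⟨Finset.mem_univ _, ?_⟩)) ?_
  · rcases u with i | p
    · by_cases h : i ∈ S <;> simp [φ, h, starSolution]
    · simp [φ, starSolution]
  · have key : ∀ (i : Fin N) (q : S × Fin t), y ((starOrder t S).symm (.inl i)) = false →
        y ((starOrder t S).symm (.inr q)) = false → φ (.inl i) ≠ φ (.inr q) := by
      intro i q hi hq h
      by_cases hS : i ∈ S
      · simp only [φ, Sum.elim_inl, Sum.elim_inr, hS, dite_true, Sum.inr.injEq] at h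
        subst h
        rw [eq_true_of_feasible hy _ hi] at hq
        cases hq
      · simp [φ, hS] at h
    rintro (i | p) hu (j | q) hv h
    · by_cases hi : i ∈ S <;> by_cases hj : j ∈ S <;> simp [φ, hi, hj] at h <;> rw [h]
    · exact absurd h (key i q (by simpa using hu) (by simpa using hv))
    · exact absurd h.symm (key j p (by simpa using hv) (by simpa using hu))
    · simpa [φ] using h

/-- The adversary's instance. -/
def starInstance (ht : 0 < t) (S : Finset (Fin N)) (b : Bool) : (Sch t).Instance where
  n := N + S.card * t
  r := fun i => starInterval S (starOrder t S i)
  x := fun i => starSolution S (starOrder t S i)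
  xhat := fun i => starPrediction b S (starOrder t S i)
  valid := starInterval_valid ht S
  optimal := fun y => by
    change acceptProfit _ y ≤ acceptProfit _ _
    rw [acceptProfit_of_feasible (starSolution_feasible S)]
    by_cases hy : ∀ i j, i ≠ j → y i = false → y j = false →
      Disjoint (starInterval S (starOrder t S i) : Set ℝ) (starInterval S (starOrder t S j))
    · exact (acceptProfit_of_feasible hy y).trans_le
        (by exact_mod_cast numAccepted_le_starSolution ht hy)
    · exact (acceptProfit_of_not_feasible hy y).trans_le bot_le

theorem optProfit_starInstance (ht : 0 < t) (S : Finset (Fin N)) (b : Bool) :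
    optProfit (starInstance ht S b) = ((N + S.card * t - S.card : ℝ) : EReal) := by
  rw [optProfit_eq]
  refine (acceptProfit_of_feasible (starSolution_feasible S) _).trans ?_
  have : (numAccepted (fun i => starSolution S (starOrder t S i)) : ℝ) + S.card =
      N + S.card * t := by
    exact_mod_cast numAccepted_starSolution (t := t) S
  rw [← this, add_sub_cancel_right]
  rfl

theorem mu0_starInstance (ht : 0 < t) (S : Finset (Fin N)) (b : Bool) :
    (mu0 (starInstance ht S b) : ℝ) = if b then 0 else (S.card : ℝ) := by
  have h := card_filter_starOrder (t := t) S
    fun u => starSolution S u = true ∧ starPrediction b S u = false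
  rw [card_filter_starIndex] at h
  rw [mu0, NNReal.coe_natCast]
  refine (congrArg Nat.cast h).trans ?_
  cases b <;> simp [starSolution, starPrediction]

theorem mu1_starInstance (ht : 0 < t) (S : Finset (Fin N)) (b : Bool) :
    (mu1 (starInstance ht S b) : ℝ) = if b then (N - S.card : ℝ) else 0 := by
  have h := card_filter_starOrder (t := t) S
    fun u => starSolution S u = false ∧ starPrediction b S u = true
  rw [card_filter_starIndex] at h
  rw [mu1, NNReal.coe_natCast]
  refine (congrArg Nat.cast h).trans ?_
  cases b
  · simp [starSolution, starPrediction]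
  · have := card_filter_not_mem_add S
    rw [if_pos rfl, eq_sub_iff_add_eq]
    simp only [starSolution, starPrediction, Sum.elim_inl, Sum.elim_inr]
    simp only [decide_eq_false_iff_not, and_true, Bool.false_eq_true, and_false,
      Finset.filter_false, Finset.card_empty, add_zero]
    exact_mod_cast this

/-- The cells accepted by an algorithm if all cells are requested with the prediction `b`. -/
def acceptedCells (A : (Sch t).Algorithm) (b : Bool) (N : ℕ) : Finset (Fin N) :=
  Finset.univ.filter fun i => A (List.ofFn fun j : Fin (i + 1) => (cell j, b)) = false

/-- Cells precede all points, so the answers on them do not depend on `S`. Hence `S` may be chosen,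
without circularity, as the set of accepted cells. -/
theorem output_starInstance (A : (Sch t).Algorithm) (ht : 0 < t) (S : Finset (Fin N)) (b : Bool)
    (i : Fin N) : Algorithm.output A (starInstance ht S b) ((starOrder t S).symm (.inl i)) =
      A (List.ofFn fun j : Fin (i + 1) => (cell j, b)) := by
  have hi : (starOrder t S).symm (.inl i) = Fin.castAdd _ i := by
    rw [Equiv.symm_apply_eq, starOrder_castAdd]
  rw [hi]
  refine congrArg A ((Instance.history_eq_ofFn (starInstance ht S b) (Fin.castAdd _ i)).trans
    (congrArg List.ofFn (funext fun j => ?_)))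
  have hj : (j : ℕ) < N := j.2.trans_le i.2
  have h : starOrder t S (Fin.castAdd _ ⟨j, hj⟩) = .inl ⟨j, hj⟩ := starOrder_castAdd S ⟨j, hj⟩
  refine Prod.ext ?_ ?_
  · exact congrArg (starInterval S) h
  · exact congrArg (starPrediction b S) h

/-- Every point lies in a cell already accepted, so a feasible output rejects all points. -/
theorem numAccepted_output_starInstance (A : (Sch t).Algorithm) (ht : 0 < t) (b : Bool)
    (h : ∀ i j, i ≠ j →
      Algorithm.output A (starInstance ht (acceptedCells A b N) b) i = false →
      Algorithm.output A (starInstance ht (acceptedCells A b N) b) j = false →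
      Disjoint (starInterval (acceptedCells A b N) (starOrder t _ i) : Set ℝ)
        (starInterval (acceptedCells A b N) (starOrder t _ j))) :
    numAccepted (Algorithm.output A (starInstance ht (acceptedCells A b N) b)) =
      (acceptedCells A b N).card := by
  set S := acceptedCells A b N with hS
  set y : Fin (N + S.card * t) → Bool := Algorithm.output A (starInstance ht S b) with hy
  have hy' := card_filter_starOrder S fun u => y ((starOrder t S).symm u) = false
  simp only [Equiv.symm_apply_apply] at hy'
  have hcell : ∀ i : Fin N, y ((starOrder t S).symm (.inl i)) = false ↔ i ∈ S := by
    intro i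
    rw [hy, output_starInstance, hS, acceptedCells, Finset.mem_filter]
    simp
  have hpoint : ∀ p, y ((starOrder t S).symm (.inr p)) = true := fun p =>
    eq_true_of_feasible h p ((hcell _).2 p.1.2)
  refine hy'.trans ?_
  rw [card_filter_starIndex]
  simp [hcell, hpoint]

/-- The bound that competitiveness gives on the adversary's instance. -/
theorem exists_star_bound {A : (Sch t).Algorithm} (ht : 0 < t) {α β γ : ℝ} (hα : 0 < α)
    (h : IsCompetitive mu0 mu1 A α β γ) : ∃ c : ℝ, ∀ (b : Bool) (N : ℕ), ∃ a : ℕ, a ≤ N ∧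
      (N + a * t - a : ℝ) ≤ α * a +
        (β * (if b then 0 else (a : ℝ)) + γ * (if b then (N - a : ℝ) else 0) + c) := by
  obtain ⟨-, -, -, c, hc⟩ := h
  refine ⟨c, fun b N => ?_⟩
  set S := acceptedCells A b N with hS
  have h := hc (starInstance ht S b)
  have hopt := optProfit_starInstance ht S b
  rw [optProfit_eq] at h hopt
  obtain ⟨hf, hle⟩ := feasible_and_le_of_acceptProfit_le (starSolution_feasible S) hα h
  have hx := (acceptProfit_of_feasible (starSolution_feasible (t := t) S) _).symm.trans hopt
  rw [EReal.coe_eq_coe_iff] at hx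
  rw [mu0_starInstance, mu1_starInstance] at hle
  refine ⟨S.card, by simpa using Finset.card_le_univ S, ?_⟩
  rw [← hx, hS]
  convert hle using 3
  exact congrArg Nat.cast (numAccepted_output_starInstance A ht b hf).symm

theorem nonpos_of_forall_nat_mul_le {a c : ℝ} (h : ∀ n : ℕ, n * a ≤ c) : a ≤ 0 := by
  by_contra! ha
  obtain ⟨n, hn⟩ := exists_nat_gt (c / a)
  rw [div_lt_iff₀ ha] at hn
  exact (h n).not_gt hn

theorem one_le_of_isCompetitive {A : (Sch t).Algorithm} (ht : 0 < t) {α β γ : ℝ}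
    (h : IsCompetitive mu0 mu1 A α β γ) : 1 ≤ α := by
  obtain ⟨hα, -, -, c, hc⟩ := h
  suffices 1 - α ≤ 0 by linarith
  refine nonpos_of_forall_nat_mul_le (c := c) fun N => ?_
  have h := hc (starInstance ht (∅ : Finset (Fin N)) false)
  have hopt := optProfit_starInstance ht (∅ : Finset (Fin N)) false
  -- With `S = ∅` and prediction `0` there are no errors and the optimum is `N`. Bounding the
  -- algorithm by the optimum needs no feasibility, so `α = 0` is covered too.
  have hle : algProfit A (starInstance ht (∅ : Finset (Fin N)) false) ≤ ((N : ℝ) : EReal) := by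
    refine (le_iSup (fun y => (Sch t).profit (starInstance ht (∅ : Finset (Fin N)) false).r y)
      _).trans (hopt.trans_le ?_)
    simp
  replace h := hopt.symm.trans_le (h.trans (add_le_add_left
    (mul_le_mul_of_nonneg_left hle (EReal.coe_nonneg.2 hα)) _))
  rw [mu0_starInstance, mu1_starInstance] at h
  have h' : (N + (∅ : Finset (Fin N)).card * t - (∅ : Finset (Fin N)).card : ℝ) ≤
      α * N + (β * (if (false : Bool) then 0 else ((∅ : Finset (Fin N)).card : ℝ)) +
        γ * (if (false : Bool) then (N - (∅ : Finset (Fin N)).card : ℝ) else 0) + c) := by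
    exact_mod_cast h
  simp at h'
  linarith

/-- The left-hand side is at least `N * min p q`, which is unbounded if both `p` and `q` are
positive. -/
theorem le_of_linear_combination_le {p q c : ℝ} (h : ∀ N : ℕ, ∃ a : ℕ, a ≤ N ∧
    (a : ℝ) * p + (N - a : ℝ) * q ≤ c) : p ≤ 0 ∨ q ≤ 0 := by
  by_contra! hpq
  refine (lt_min hpq.1 hpq.2).not_ge (nonpos_of_forall_nat_mul_le (c := c) fun N => ?_)
  obtain ⟨a, ha, h⟩ := h N
  have ha' : (a : ℝ) ≤ N := by exact_mod_cast ha
  nlinarith [mul_le_mul_of_nonneg_left (min_le_left p q) (Nat.cast_nonneg (α := ℝ) a),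
    mul_le_mul_of_nonneg_left (min_le_right p q) (sub_nonneg.2 ha')]

theorem le_add_of_isCompetitive {A : (Sch t).Algorithm} (ht : 0 < t) {α β γ : ℝ}
    (h : IsCompetitive mu0 mu1 A α β γ) : (t : ℝ) ≤ α + β := by
  obtain ⟨c, hc⟩ := exists_star_bound ht (by linarith [one_le_of_isCompetitive ht h]) h
  -- Prediction `0`: each accepted cell is an error counted by `μ₀` and loses `t - α - β`, each
  -- rejected cell loses `1`.
  have := le_of_linear_combination_le (p := t - α - β) (q := 1) (c := c) fun N => by
    obtain ⟨a, ha, h⟩ := hc false N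
    refine ⟨a, ha, ?_⟩
    simp at h
    linarith
  rcases this with h | h <;> linarith

theorem le_or_one_le_of_isCompetitive {A : (Sch t).Algorithm} (ht : 0 < t) {α β γ : ℝ}
    (h : IsCompetitive mu0 mu1 A α β γ) : (t : ℝ) ≤ α ∨ 1 ≤ γ := by
  obtain ⟨c, hc⟩ := exists_star_bound ht (by linarith [one_le_of_isCompetitive ht h]) h
  -- Prediction `1`: the errors are now the rejected cells, counted by `μ₁`, so `γ` offsets their
  -- loss and `β` plays no role.
  have := le_of_linear_combination_le (p := t - α) (q := 1 - γ) (c := c) fun N => by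
    obtain ⟨a, ha, h⟩ := hc true N
    refine ⟨a, ha, ?_⟩
    simp at h
    linarith
  exact this.imp (by intro h; linarith) (by intro h; linarith)

end Adversary

theorem mainTheorem4 (t : ℕ) (ht : 0 < t) :
    OnlineMaxProblem.ExactlyAsHardAs (Sch t) (BDIS t)
      OnlineMaxProblem.mu0 OnlineMaxProblem.mu1 OnlineMaxProblem.mu0 OnlineMaxProblem.mu1 := by
  refine ⟨fun α β γ ⟨A, hA, _⟩ => ?_, fun α β γ ⟨A, hA, _⟩ =>
    ⟨overlapAlgorithm A, isCompetitive_overlapAlgorithm hA⟩⟩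
  rcases le_or_one_le_of_isCompetitive ht hA with h | h
  · exact ⟨_, isCompetitive_greedy h ht hA.2.1 hA.2.2.1⟩
  · exact ⟨_, isCompetitive_trusting (one_le_of_isCompetitive ht hA) hA.2.1
      (le_add_of_isCompetitive ht hA) h⟩

end
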